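/- **Theorem 4.1.** All manifolds are smooth, finite-dimensional, Hausdorff and without boundary; all forms and maps are smooth. A differential form $\beta$ on a manifold with Riemannian metric $g$ is *bounded* if $\sup_x|\beta(x)|_g<\infty$. A form $\alpha$ of degree $k\ge 1$ on a connected Riemannian manifold $(Y,g)$ with universal covering $\pi:\tilde Y\to Y$ is *$\tilde d$-bounded* if there is a $(k-1)$-form $\beta$ on $\tilde Y$ that is bounded with respect to $\pi^*g$ and satisfies $\pi^*\alpha=d\beta$. We say that $(Y,g)$ has *$\tilde d$-bounded $H^2_{\mathrm{DR}}(Y,\mathbb R)$* if every class in $H^2_{\mathrm{DR}}(Y,\mathbb R)$ is represented by a closed $\tilde d$-bounded $2$-form. Let $X$ be a compact manifold with a symplectic form $\omega$ (a closed nondegenerate $2$-form), and let $(Y,g)$ be a compact connected Riemannian manifold with $\tilde d$-bounded $H^2_{\mathrm{DR}}(Y,\mathbb R)$. Suppose there are smooth maps $f_1:X\to Y$ and $f_2:Y\to X$ such that the image of the induced map $$(f_2\circ f_1)^*:H^2_{\mathrm{DR}}(X,\mathbb R)\to H^2_{\mathrm{DR}}(X,\mathbb R)$$ contains the class $[\omega]$.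 Let $J$ be any smooth almost complex structure on $X$ compatible with $\omega$, that is, at every point $\omega(v,Jv)>0$ for all tangent vectors $v\neq0$ and $\omega(Jv,Jw)=\omega(v,w)$ for all tangent vectors $v,w$. Then there is no non-constant $J$-holomorphic map $f:\mathbb C\to X$, i.e. no non-constant smooth map with $df(iv)=J\,df(v)$ for all tangent vectors $v$ of $\mathbb C$. -/

import Mathlib

open Set Filter Topology Manifold ContDiff

namespace DiffForm

section Alt
variable {E F : Type*} [NormedAddCommGroup E] [NormedSpace ℝ E] [NormedAddCommGroup F]
  [NormedSpace ℝ F] {k : ℕ}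

/-- Alternatization as a continuous linear map. -/
noncomputable def alternatizationCLM (E : Type*) [NormedAddCommGroup E] [NormedSpace ℝ E] (k : ℕ) :
    ContinuousMultilinearMap ℝ (fun _ : Fin k => E) ℝ →L[ℝ] E [⋀^Fin k]→L[ℝ] ℝ :=
  LinearMap.mkContinuous
    { toFun := fun m => ContinuousMultilinearMap.alternatization m
      map_add' := fun m n => by simp
      map_smul' := fun c m => by
        ext v
        simp [ContinuousMultilinearMap.alternatization_apply_apply, Finset.mul_sum, mul_left_comm,
          Units.smul_def] }
    (Fintype.card (Equiv.Perm (Fin k)))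
    (fun m => by
      refine ContinuousAlternatingMap.opNorm_le_bound _ (by positivity) fun v => ?_
      simp only [LinearMap.coe_mk, AddHom.coe_mk,
        ContinuousMultilinearMap.alternatization_apply_apply]
      refine (norm_sum_le _ _).trans ?_
      refine (Finset.sum_le_card_nsmul _ _ (‖m‖ * ∏ i, ‖v i‖) fun σ _ => ?_).trans ?_
      · have h1 : ‖Equiv.Perm.sign σ • m (v ∘ σ)‖ = ‖m (v ∘ σ)‖ := by
          rcases Int.units_eq_one_or (Equiv.Perm.sign σ) with h | h <;> simp [h]
        rw [h1]
        refine (m.le_opNorm _).trans_eq ?_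
        congr 1
        exact Equiv.prod_comp σ (fun i => ‖v i‖)
      · simp [mul_assoc])

theorem alternatizationCLM_coe (g : E [⋀^Fin k]→L[ℝ] ℝ) :
    alternatizationCLM E k g.toContinuousMultilinearMap = (k.factorial : ℝ) • g := by
  ext v
  simp only [alternatizationCLM, LinearMap.mkContinuous_apply, LinearMap.coe_mk, AddHom.coe_mk,
    ContinuousMultilinearMap.alternatization_apply_apply]
  have : ∀ σ : Equiv.Perm (Fin k), Equiv.Perm.sign σ • g (v ∘ σ) = g v := fun σ => by
    have h0 : g (v ∘ σ) = Equiv.Perm.sign σ • g v := g.toAlternatingMap.map_perm v σ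
    rw [h0]
    rcases Int.units_eq_one_or (Equiv.Perm.sign σ) with h | h <;> simp [h]
  simp [this, Fintype.card_perm]

/-- The pullback of an alternating form along a linear map depends smoothly on both. -/
theorem contDiff_compContinuousLinearMap :
    ContDiff ℝ ∞ (fun p : (F [⋀^Fin k]→L[ℝ] ℝ) × (E →L[ℝ] F) =>
      p.1.compContinuousLinearMap p.2) := by
  have h1 : ContDiff ℝ ∞ (fun p : (F [⋀^Fin k]→L[ℝ] ℝ) × (E →L[ℝ] F) =>
      ContinuousMultilinearMap.compContinuousLinearMapContinuousMultilinear ℝ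
        (fun _ : Fin k => E) (fun _ : Fin k => F) ℝ (fun _ => p.2)
        (ContinuousAlternatingMap.toContinuousMultilinearMapCLM ℝ p.1)) := by
    refine ContDiff.clm_apply ?_ ?_
    · refine (ContinuousMultilinearMap.contDiff _).comp ?_
      exact contDiff_pi.2 fun _ => contDiff_snd
    · exact (ContinuousLinearMap.contDiff _).comp contDiff_fst
  have h2 := (((k.factorial : ℝ)⁻¹) • alternatizationCLM E k).contDiff (n := ∞) |>.comp h1
  convert! h2 using 1
  funext p
  have h3 : ContinuousMultilinearMap.compContinuousLinearMapContinuousMultilinear ℝ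
        (fun _ : Fin k => E) (fun _ : Fin k => F) ℝ (fun _ => p.2)
        (ContinuousAlternatingMap.toContinuousMultilinearMapCLM ℝ p.1)
      = (p.1.compContinuousLinearMap p.2).toContinuousMultilinearMap := by
    ext v; rfl
  simp only [Function.comp_apply, h3, smul_apply, alternatizationCLM_coe]
  rw [smul_smul, inv_mul_cancel₀ (by positivity), one_smul]

theorem compCLM_congr {E E' T : Type*} [NormedAddCommGroup E] [NormedSpace ℝ E]
    [NormedAddCommGroup E'] [NormedSpace ℝ E'] {k : ℕ} (a : T → E' [⋀^Fin k]→L[ℝ] ℝ) {p q : T} (h : p = q) (A : E →L[ℝ] E') :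
    (a p).compContinuousLinearMap A = (a q).compContinuousLinearMap A := by
  rw [h]

end Alt

section Raw
variable {E : Type*} [NormedAddCommGroup E] [NormedSpace ℝ E]
  {E' : Type*} [NormedAddCommGroup E'] [NormedSpace ℝ E']
  {X : Type*} [TopologicalSpace X] [ChartedSpace E X]
  {X' : Type*} [TopologicalSpace X'] [ChartedSpace E' X'] {k : ℕ}

variable (E X k) in
/-- A (not necessarily smooth) differential `k`-form: an alternating `k`-linear form on each
tangent space. -/
abbrev RawForm := ∀ x : X, TangentSpace 𝓘(ℝ, E) x [⋀^Fin k]→L[ℝ] ℝ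

variable (E E') in
/-- The pullback `f^*α`, i.e. `(f^*α)_x (v₁, …, v_k) = α_{f x} (df v₁, …, df v_k)`. -/
noncomputable def rawPullback (f : X → X') (α : RawForm E' X' k) : RawForm E X k := fun x =>
  (α (f x)).compContinuousLinearMap (mfderiv 𝓘(ℝ, E) 𝓘(ℝ, E') f x)

/-- A form on the vector space `E`, with each tangent space identified with `E`. -/
def onModel (α : RawForm E E k) : E → E [⋀^Fin k]→L[ℝ] ℝ := α

/-- A form written in the chart at `x₀`. -/
noncomputable def inChart (x₀ : X) (α : RawForm E X k) : E → E [⋀^Fin k]→L[ℝ] ℝ :=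
  onModel (rawPullback E E (chartAt E x₀).symm α)

/-- The exterior derivative: in the chart at `x`, it is the exterior derivative of forms on `E`. -/
noncomputable def rawD (α : RawForm E X k) : RawForm E X (k + 1) := fun x =>
  ContinuousAlternatingMap.compContinuousLinearMap
    (extDeriv (inChart x α) (chartAt E x x) : E [⋀^Fin (k + 1)]→L[ℝ] ℝ)
    (mfderiv 𝓘(ℝ, E) 𝓘(ℝ, E) (chartAt E x) x)

/-- A differential form is smooth if its expressions in the charts are smooth. -/
def IsSmoothForm (α : RawForm E X k) : Prop :=
  ∀ x₀ : X, ContDiffOn ℝ ∞ (inChart x₀ α) (chartAt E x₀).target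

theorem rawPullback_comp {X'' E'' : Type*} [NormedAddCommGroup E''] [NormedSpace ℝ E'']
    [TopologicalSpace X''] [ChartedSpace E'' X''] {h : X'' → X} {f : X → X'} {y : X''}
    (hf : MDifferentiableAt 𝓘(ℝ, E) 𝓘(ℝ, E') f (h y))
    (hh : MDifferentiableAt 𝓘(ℝ, E'') 𝓘(ℝ, E) h y) (α : RawForm E' X' k) :
    rawPullback E'' E h (rawPullback E E' f α) y = rawPullback E'' E' (f ∘ h) α y := by
  simp only [rawPullback]
  rw [mfderiv_comp y hf hh]
  rfl

theorem rawPullback_congr {f g : X → X'} {x : X} (h : f =ᶠ[𝓝 x] g) (α : RawForm E' X' k) :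
    rawPullback E E' f α x = rawPullback E E' g α x := by
  have e1 := h.mfderiv_eq (I := 𝓘(ℝ, E)) (I' := 𝓘(ℝ, E'))
  simp only [rawPullback]
  rw [e1]
  exact compCLM_congr (E := E) (E' := E') α h.self_of_nhds _

variable [IsManifold 𝓘(ℝ, E) ∞ X]

theorem mdiffAt_chart {x₀ x : X} (hx : x ∈ (chartAt E x₀).source) :
    ContMDiffAt 𝓘(ℝ, E) 𝓘(ℝ, E) ∞ (chartAt E x₀) x :=
  (contMDiffOn_chart (I := 𝓘(ℝ, E)) (n := ∞)).contMDiffAt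
    ((chartAt E x₀).open_source.mem_nhds hx)

theorem mdiffAt_chart_symm {x₀ : X} {y : E} (hy : y ∈ (chartAt E x₀).target) :
    ContMDiffAt 𝓘(ℝ, E) 𝓘(ℝ, E) ∞ (chartAt E x₀).symm y :=
  (contMDiffOn_chart_symm (I := 𝓘(ℝ, E)) (n := ∞)).contMDiffAt
    ((chartAt E x₀).open_target.mem_nhds hy)

variable [IsManifold 𝓘(ℝ, E') ∞ X']

/-- Pulling back along `h` may be computed in a chart of the target. -/
theorem rawPullback_eq {h : E → X'} {y : E} {x₀ : X'}
    (hh : ContMDiffAt 𝓘(ℝ, E) 𝓘(ℝ, E') ∞ h y) (hy : h y ∈ (chartAt E' x₀).source)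
    (α : RawForm E' X' k) :
    onModel (rawPullback E E' h α) y = (inChart x₀ α (chartAt E' x₀ (h y))).compContinuousLinearMap
      (fderiv ℝ (chartAt E' x₀ ∘ h) y) := by
  have hT : (chartAt E' x₀) (h y) ∈ (chartAt E' x₀).target := (chartAt E' x₀).map_source hy
  have h1 : MDifferentiableAt 𝓘(ℝ, E) 𝓘(ℝ, E') (chartAt E' x₀ ∘ h) y :=
    ((mdiffAt_chart hy).comp y hh).mdifferentiableAt (by simp)
  have h2 := rawPullback_comp (h := (chartAt E' x₀ ∘ h : E → E')) (f := (chartAt E' x₀).symm)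
    (y := y) ((mdiffAt_chart_symm hT).mdifferentiableAt (by simp)) h1 α
  have h3 : (chartAt E' x₀).symm ∘ (chartAt E' x₀ ∘ h) =ᶠ[𝓝 y] h := by
    filter_upwards [hh.continuousAt.preimage_mem_nhds
      ((chartAt E' x₀).open_source.mem_nhds hy)] with z hz
    exact (chartAt E' x₀).left_inv hz
  rw [onModel, ← rawPullback_congr h3 α, ← h2, ← mfderiv_eq_fderiv]
  rfl


/-- Pullback of a smooth form along a smooth map from (an open subset of) `E` is smooth. -/
theorem contDiffAt_rawPullback {h : E → X'} {y : E} {α : RawForm E' X' k} (hα : IsSmoothForm α)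
    (hh : ∀ᶠ z in 𝓝 y, ContMDiffAt 𝓘(ℝ, E) 𝓘(ℝ, E') ∞ h z) :
    ContDiffAt ℝ ∞ (onModel (rawPullback E E' h α)) y ∧
    extDeriv (onModel (rawPullback E E' h α)) y =
      onModel (rawPullback E E' h (rawD α)) y := by
  set χ := chartAt E' (h y) with hχ
  have hy : h y ∈ χ.source := mem_chart_source E' (h y)
  have hhy := hh.self_of_nhds
  have hτ : ContDiffAt ℝ ∞ (χ ∘ h) y := ((mdiffAt_chart hy).comp y hhy).contDiffAt
  have hev : ∀ᶠ z in 𝓝 y, onModel (rawPullback E E' h α) z =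
      (inChart (h y) α ((χ ∘ h) z)).compContinuousLinearMap (fderiv ℝ (χ ∘ h) z) := by
    filter_upwards [hh, hhy.continuousAt.preimage_mem_nhds (χ.open_source.mem_nhds hy)]
      with z hz1 hz2
    exact rawPullback_eq hz1 hz2 α
  have hsm : ContDiffAt ℝ ∞ (inChart (h y) α) ((χ ∘ h) y) :=
    (hα (h y)).contDiffAt (χ.open_target.mem_nhds (χ.map_source hy))
  refine ⟨?_, ?_⟩
  · refine ContDiffAt.congr_of_eventuallyEq ?_ hev
    exact contDiff_compContinuousLinearMap.contDiffAt.comp y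
      ((hsm.comp y hτ).prodMk (hτ.fderiv_right (m := ∞) (by simp)))
  · rw [Filter.EventuallyEq.extDeriv_eq hev,
      extDeriv_pullback (hsm.differentiableAt (by simp)) hτ
      (by simpa using (ENat.LEInfty.out : (2 : WithTop ℕ∞) ≤ ∞))]
    have e1 : fderiv ℝ (χ ∘ h) y =
        (mfderiv 𝓘(ℝ, E') 𝓘(ℝ, E') χ (h y)).comp (mfderiv 𝓘(ℝ, E) 𝓘(ℝ, E') h y) := by
      rw [← mfderiv_comp y ((mdiffAt_chart hy).mdifferentiableAt (by simp))
        (hhy.mdifferentiableAt (by simp)), mfderiv_eq_fderiv]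
    rw [e1]
    rfl

theorem IsSmoothForm.rawD {α : RawForm E X k} (hα : IsSmoothForm α) :
    IsSmoothForm (rawD α) := by
  intro x₀ y hy
  have hh : ∀ᶠ z in 𝓝 y, ContMDiffAt 𝓘(ℝ, E) 𝓘(ℝ, E) ∞ (chartAt E x₀).symm z := by
    filter_upwards [(chartAt E x₀).open_target.mem_nhds hy] with z hz
    exact mdiffAt_chart_symm hz
  have hev : inChart x₀ (DiffForm.rawD α) =ᶠ[𝓝 y] extDeriv (inChart x₀ α) := by
    filter_upwards [hh.eventually_nhds] with z hz
    exact (contDiffAt_rawPullback hα hz).2.symm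
  refine ContDiffAt.contDiffWithinAt (ContDiffAt.congr_of_eventuallyEq ?_ hev)
  have h1 := (contDiffAt_rawPullback hα hh).1
  exact (ContinuousAlternatingMap.alternatizeUncurryFinCLM ℝ E ℝ (n := k)).contDiff.contDiffAt.comp y
    (h1.fderiv_right (m := ∞) (by simp))

theorem IsSmoothForm.pullback {f : X → X'} (hf : ContMDiff 𝓘(ℝ, E) 𝓘(ℝ, E') ∞ f)
    {α : RawForm E' X' k} (hα : IsSmoothForm α) : IsSmoothForm (rawPullback E E' f α) := by
  intro x₀ y hy
  have hh : ∀ᶠ z in 𝓝 y, ContMDiffAt 𝓘(ℝ, E) 𝓘(ℝ, E) ∞ (chartAt E x₀).symm z := by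
    filter_upwards [(chartAt E x₀).open_target.mem_nhds hy] with z hz
    exact mdiffAt_chart_symm hz
  refine ContDiffAt.contDiffWithinAt (ContDiffAt.congr_of_eventuallyEq
    (contDiffAt_rawPullback (h := f ∘ (chartAt E x₀).symm) hα
      (hh.mono fun z hz => hf.contMDiffAt.comp z hz)).1 ?_)
  filter_upwards [hh] with z hz
  exact rawPullback_comp (hf.mdifferentiable (by simp) _) (hz.mdifferentiableAt (by simp)) α

/-- The exterior derivative commutes with pullback. -/
theorem rawD_rawPullback {f : X → X'} (hf : ContMDiff 𝓘(ℝ, E) 𝓘(ℝ, E') ∞ f)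
    {α : RawForm E' X' k} (hα : IsSmoothForm α) :
    rawD (rawPullback E E' f α) = rawPullback E E' f (rawD α) := by
  funext x
  have hx := mem_chart_source E x
  have hy : chartAt E x x ∈ (chartAt E x).target := (chartAt E x).map_source hx
  have hh : ∀ᶠ z in 𝓝 (chartAt E x x),
      ContMDiffAt 𝓘(ℝ, E) 𝓘(ℝ, E) ∞ (chartAt E x).symm z := by
    filter_upwards [(chartAt E x).open_target.mem_nhds hy] with z hz
    exact mdiffAt_chart_symm hz
  have h1 : inChart x (rawPullback E E' f α) =ᶠ[𝓝 (chartAt E x x)]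
      onModel (rawPullback E E' (f ∘ (chartAt E x).symm) α) := by
    filter_upwards [hh] with z hz
    exact rawPullback_comp (hf.mdifferentiable (by simp) _) (hz.mdifferentiableAt (by simp)) α
  have h2 := (contDiffAt_rawPullback (h := f ∘ (chartAt E x).symm) hα
      (hh.mono fun z hz => hf.contMDiffAt.comp z hz)).2
  have h3 : rawD (rawPullback E E' f α) x = rawPullback E E (chartAt E x)
      (rawPullback E E' (f ∘ (chartAt E x).symm) (rawD α)) x := by
    simp only [rawD, h1.extDeriv_eq, h2]
    rfl
  have h4 : (f ∘ (chartAt E x).symm) ∘ chartAt E x =ᶠ[𝓝 x] f := by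
    filter_upwards [(chartAt E x).open_source.mem_nhds hx] with z hz
    simp [(chartAt E x).left_inv hz]
  rw [h3, rawPullback_comp _ ((mdiffAt_chart hx).mdifferentiableAt (by simp)),
    rawPullback_congr h4]
  exact ((hf _).comp _ hh.self_of_nhds).mdifferentiableAt (by simp)

end Raw

section Forms
variable {E : Type*} [NormedAddCommGroup E] [NormedSpace ℝ E]
  {E' : Type*} [NormedAddCommGroup E'] [NormedSpace ℝ E']
  {X : Type*} [TopologicalSpace X] [ChartedSpace E X]
  {X' : Type*} [TopologicalSpace X'] [ChartedSpace E' X'] {k : ℕ}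

variable (E X k) in
/-- The smooth differential `k`-forms, as a subspace of all differential forms. -/
def smoothForms : Submodule ℝ (RawForm E X k) where
  carrier := {α | IsSmoothForm α}
  add_mem' := fun ha hb x₀ => (ha x₀).add (hb x₀)
  zero_mem' := fun _ => contDiffOn_const (c := 0)
  smul_mem' := fun c _ ha x₀ => (ha x₀).const_smul c

variable (E X k) in
/-- The space `Ω^k(X)` of smooth differential `k`-forms. -/
def Form : Type _ := smoothForms E X k

noncomputable instance : AddCommGroup (Form E X k) :=
  inferInstanceAs (AddCommGroup (smoothForms E X k))

noncomputable instance : Module ℝ (Form E X k) :=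
  inferInstanceAs (Module ℝ (smoothForms E X k))

theorem differentiableAt_inChart (α : Form E X k) (x : X) :
    DifferentiableAt ℝ (inChart x α.1) (chartAt E x x) :=
  ((α.2 x).contDiffAt ((chartAt E x).open_target.mem_nhds
    ((chartAt E x).map_source (mem_chart_source E x)))).differentiableAt (by simp)

variable [IsManifold 𝓘(ℝ, E) ∞ X] [IsManifold 𝓘(ℝ, E') ∞ X']

/-- The exterior derivative `d : Ω^k(X) → Ω^{k+1}(X)`. -/
noncomputable def d : Form E X k →ₗ[ℝ] Form E X (k + 1) where
  toFun := fun α => ⟨rawD α.1, IsSmoothForm.rawD α.2⟩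
  map_add' := fun α β => by
    refine Subtype.ext (funext fun x => ?_)
    change ContinuousAlternatingMap.compContinuousLinearMap
      (extDeriv (inChart x α.1 + inChart x β.1) (chartAt E x x)) _ = _
    rw [extDeriv_add (differentiableAt_inChart α x) (differentiableAt_inChart β x)]
    rfl
  map_smul' := fun c α => by
    refine Subtype.ext (funext fun x => ?_)
    change ContinuousAlternatingMap.compContinuousLinearMap
      (extDeriv (c • inChart x α.1) (chartAt E x x)) _ = _
    rw [extDeriv_smul]
    rfl

/-- The pullback `f^* : Ω^k(X') → Ω^k(X)` along a smooth map `f : X → X'`. -/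
noncomputable def pullback (f : C^∞⟮𝓘(ℝ, E), X; 𝓘(ℝ, E'), X'⟯) (k : ℕ) :
    Form E' X' k →ₗ[ℝ] Form E X k where
  toFun := fun α => ⟨rawPullback E E' f α.1, IsSmoothForm.pullback f.contMDiff α.2⟩
  map_add' := fun _ _ => rfl
  map_smul' := fun _ _ => rfl

theorem d_pullback (f : C^∞⟮𝓘(ℝ, E), X; 𝓘(ℝ, E'), X'⟯) (α : Form E' X' k) :
    d (pullback f k α) = pullback f (k + 1) (d α) :=
  Subtype.ext (rawD_rawPullback f.contMDiff α.2)

variable (E X) in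
/-- The closed `k`-forms. -/
noncomputable def closedForms (k : ℕ) : Submodule ℝ (Form E X k) := LinearMap.ker d

variable (E X) in
/-- The exact `k`-forms; in degree `0` only the zero form is exact. -/
noncomputable def exactForms : (k : ℕ) → Submodule ℝ (Form E X k)
  | 0 => ⊥
  | _ + 1 => LinearMap.range d

variable (E X) in
/-- The de Rham cohomology `H^k_DR(X, ℝ)`: closed `k`-forms modulo exact `k`-forms. -/
abbrev DeRhamCohomology (k : ℕ) : Type _ :=
  closedForms E X k ⧸ (exactForms E X k).comap (closedForms E X k).subtype

/-- The cohomology class of a closed form. -/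
noncomputable def deRhamClass (α : Form E X k) (hα : d α = 0) : DeRhamCohomology E X k :=
  Submodule.Quotient.mk ⟨α, hα⟩

theorem pullback_mem_closedForms (f : C^∞⟮𝓘(ℝ, E), X; 𝓘(ℝ, E'), X'⟯) (k : ℕ)
    (α : Form E' X' k) (hα : α ∈ closedForms E' X' k) :
    pullback f k α ∈ closedForms E X k := by
  have h : d α = 0 := hα
  change d (pullback f k α) = 0
  rw [d_pullback, h, map_zero]

theorem pullback_mem_exactForms (f : C^∞⟮𝓘(ℝ, E), X; 𝓘(ℝ, E'), X'⟯) (k : ℕ)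
    (α : Form E' X' k) (hα : α ∈ exactForms E' X' k) :
    pullback f k α ∈ exactForms E X k := by
  cases k with
  | zero =>
    have h : α = 0 := hα
    rw [h, map_zero]
    exact Submodule.zero_mem _
  | succ k =>
    obtain ⟨β, rfl⟩ := hα
    exact ⟨pullback f k β, d_pullback f β⟩

/-- The induced map `f^* : H^k_DR(X', ℝ) → H^k_DR(X, ℝ)`, `f^*[α] = [f^*α]`. -/
noncomputable def deRhamMap (f : C^∞⟮𝓘(ℝ, E), X; 𝓘(ℝ, E'), X'⟯) (k : ℕ) :
    DeRhamCohomology E' X' k →ₗ[ℝ] DeRhamCohomology E X k :=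
  Submodule.mapQ _ _ ((pullback f k).restrict (pullback_mem_closedForms f k))
    (fun α hα => pullback_mem_exactForms f k α.1 hα)

end Forms

section Bounded
universe u
variable {E : Type*} [NormedAddCommGroup E] [NormedSpace ℝ E]
  {X : Type*} [TopologicalSpace X] [ChartedSpace E X] {k : ℕ}

/-- `sup_x |β(x)|_G < ∞`, where `|β(x)|_G` is the operator norm of the multilinear form `β(x)` with
respect to the lengths `√(G_x(v, v))` of tangent vectors. (All norms on the forms on an inner
product space that are induced by its inner product are equivalent, with constants depending only
on dimension and degree, so the condition does not depend on the choice of such a norm.) -/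
def IsBoundedForm (G : ∀ x : X, TangentSpace 𝓘(ℝ, E) x → TangentSpace 𝓘(ℝ, E) x → ℝ)
    (β : Form E X k) : Prop :=
  ∃ C : ℝ, ∀ (x : X) (v : Fin k → TangentSpace 𝓘(ℝ, E) x),
    |β.1 x v| ≤ C * ∏ i, √(G x (v i) (v i))

/-- A form `α` is `d`-bounded if `α = dβ` for a smooth form `β` that is bounded. (In degree `0`
there is no `β`, and only `0` counts.) -/
def IsDBounded [IsManifold 𝓘(ℝ, E) ∞ X]
    (G : ∀ x : X, TangentSpace 𝓘(ℝ, E) x → TangentSpace 𝓘(ℝ, E) x → ℝ) :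
    {k : ℕ} → Form E X k → Prop
  | 0, α => α = 0
  | _ + 1, α => ∃ β, α = d β ∧ IsBoundedForm G β

/-- A universal covering of the manifold `Y`: a simply connected smooth manifold with a surjective
covering map to `Y` that is a local diffeomorphism. -/
structure UniversalCovering (F : Type*) [NormedAddCommGroup F] [NormedSpace ℝ F]
    (Y : Type u) [TopologicalSpace Y] [ChartedSpace F Y] where
  carrier : Type u
  [topologicalSpace : TopologicalSpace carrier]
  [chartedSpace : ChartedSpace F carrier]
  [isManifold : IsManifold 𝓘(ℝ, F) ∞ carrier]
  [simplyConnected : SimplyConnectedSpace carrier]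
  proj : C^∞⟮𝓘(ℝ, F), carrier; 𝓘(ℝ, F), Y⟯
  isCoveringMap : IsCoveringMap proj
  surjective : Function.Surjective proj
  isLocalDiffeomorph : IsLocalDiffeomorph 𝓘(ℝ, F) 𝓘(ℝ, F) ∞ proj

attribute [instance] UniversalCovering.topologicalSpace UniversalCovering.chartedSpace
  UniversalCovering.isManifold UniversalCovering.simplyConnected

variable {F : Type*} [NormedAddCommGroup F] [NormedSpace ℝ F]
  {Y : Type u} [TopologicalSpace Y] [ChartedSpace F Y] [IsManifold 𝓘(ℝ, F) ∞ Y]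

/-- The metric `π^*g` on the universal covering. -/
noncomputable def UniversalCovering.metric (U : UniversalCovering F Y)
    (g : Bundle.ContMDiffRiemannianMetric 𝓘(ℝ, F) ∞ F
      (fun y : Y => TangentSpace 𝓘(ℝ, F) y)) :
    ∀ x : U.carrier, TangentSpace 𝓘(ℝ, F) x → TangentSpace 𝓘(ℝ, F) x → ℝ := fun x v w =>
  g.inner (U.proj x) (mfderiv 𝓘(ℝ, F) 𝓘(ℝ, F) U.proj x v) (mfderiv 𝓘(ℝ, F) 𝓘(ℝ, F) U.proj x w)

/-- A form `α` on the Riemannian manifold `(Y, g)` is `d̃`-bounded if `π^*α` is `d`-bounded on the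
universal covering `π : (Ỹ, π^*g) → (Y, g)`. -/
def IsTildeDBounded (g : Bundle.ContMDiffRiemannianMetric 𝓘(ℝ, F) ∞ F
      (fun y : Y => TangentSpace 𝓘(ℝ, F) y)) (α : Form F Y k) : Prop :=
  ∃ U : UniversalCovering F Y, IsDBounded (U.metric g) (pullback U.proj k α)

/-- `(Y, g)` has `d̃`-bounded `k`-th cohomology: every class in `H^k_DR(Y, ℝ)` is represented by a
`d̃`-bounded closed form. (If `Y` is compact, then all representatives are `d̃`-bounded.) -/
def HasTildeDBoundedCohomology (g : Bundle.ContMDiffRiemannianMetric 𝓘(ℝ, F) ∞ F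
      (fun y : Y => TangentSpace 𝓘(ℝ, F) y)) (k : ℕ) : Prop :=
  ∀ c : DeRhamCohomology F Y k, ∃ (α : Form F Y k) (hα : d α = 0),
    deRhamClass α hα = c ∧ IsTildeDBounded g α

end Bounded

section Symplectic
variable {E : Type*} [NormedAddCommGroup E] [NormedSpace ℝ E]
  {X : Type*} [TopologicalSpace X] [ChartedSpace E X] [IsManifold 𝓘(ℝ, E) ∞ X]

/-- A symplectic form: a closed nondegenerate smooth `2`-form. -/
structure IsSymplectic (Ω : Form E X 2) : Prop where
  closed : d Ω = 0
  nondegenerate : ∀ (x : X) (v : TangentSpace 𝓘(ℝ, E) x),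
    (∀ w : TangentSpace 𝓘(ℝ, E) x, Ω.1 x ![v, w] = 0) → v = 0

variable (E X) in
/-- A smooth almost complex structure: a smooth field of endomorphisms `J` of the tangent spaces
with `J² = -1`. -/
structure AlmostComplexStructure where
  toFun : ∀ x : X, TangentSpace 𝓘(ℝ, E) x →L[ℝ] TangentSpace 𝓘(ℝ, E) x
  smooth : ContMDiff 𝓘(ℝ, E) (𝓘(ℝ, E).prod 𝓘(ℝ, E →L[ℝ] E)) ∞
    (fun x => Bundle.TotalSpace.mk' (E →L[ℝ] E)
      (E := fun x : X => TangentSpace 𝓘(ℝ, E) x →L[ℝ] TangentSpace 𝓘(ℝ, E) x) x (toFun x))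
  sq_eq_neg : ∀ (x : X) (v : TangentSpace 𝓘(ℝ, E) x), toFun x (toFun x v) = -v

/-- `Ω` is compatible with `J`: it tames `J` and is `J`-invariant. -/
structure IsCompatible (Ω : Form E X 2) (J : AlmostComplexStructure E X) : Prop where
  tames : ∀ (x : X) (v : TangentSpace 𝓘(ℝ, E) x), v ≠ 0 → 0 < Ω.1 x ![v, J.toFun x v]
  invariant : ∀ (x : X) (v w : TangentSpace 𝓘(ℝ, E) x),
    Ω.1 x ![J.toFun x v, J.toFun x w] = Ω.1 x ![v, w]

/-- A `J`-holomorphic map `f : ℂ → X`: a smooth map with `df ∘ i = J ∘ df`. -/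
structure IsJHolomorphic (J : AlmostComplexStructure E X) (f : ℂ → X) : Prop where
  smooth : ContMDiff 𝓘(ℝ, ℂ) 𝓘(ℝ, E) ∞ f
  map_I_mul : ∀ z v : ℂ, mfderiv 𝓘(ℝ, ℂ) 𝓘(ℝ, E) f z (Complex.I * v : ℂ) =
    J.toFun (f z) (mfderiv 𝓘(ℝ, ℂ) 𝓘(ℝ, E) f z v)

end Symplectic

end DiffForm

/-! Write `D` for the differential of a `J`-holomorphic plane `f`. Since `D i = J (D 1)`, the
pullback `f^*Ω` is `u dx ∧ dy` with `u = Ω(D 1, J D 1) ≥ 0`, and taming makes `u` vanish exactly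
where `D` does. It therefore suffices to prove `u = 0`.

The hypothesis on cohomology gives `[Ω] = f₁^*(f₂^*c)`, and `f₂^*c` lives on `Y`, so `Ω = f₁^*α +
dη` with `α` `d̃`-bounded (`exists_eq_pullback_add_d`). The plane is simply connected, so `f₁ ∘ f`
lifts to a map `h` into the universal covering (`UniversalCovering.exists_lift`), where `π^*α = dβ`
with `β` bounded. Hence `f^*Ω = dθ` with `θ = h^*β + f^*η`. Compactness of `X` bounds the lengths of
`df₁(v)` and the values `|η(v)|` by multiples of `√Ω(v, Jv)` (`exists_le_mul_of_homogeneous`), so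
the coefficients of `θ` are at most a constant times `√u`.

Such a primitive forces `u = 0` (`eq_zero_of_primitive_le`). Testing `dθ` against `φ²` for a cutoff
`φ` at scale `R` bounds the energy by a small contribution of the annulus where `dφ ≠ 0`. Dirichlet
energy is scale invariant in real dimension two, so the error stays bounded as `R → ∞`. -/

namespace DiffForm

/-! ### Energy estimates on the plane. -/

section Plane
open MeasureTheory

/-- The energy inequality for a cutoff function `φ` and a two-form `u = dθ` on the plane with
`θ = p dx + q dy` bounded by `√u`. -/
theorem integral_sq_mul_le_of_primitive_le {p q u φ : ℂ → ℝ} {C B δ : ℝ} {A : Set ℂ}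
    (hp : ContDiff ℝ 1 p) (hq : ContDiff ℝ 1 q) (hu : ∀ z, 0 ≤ u z)
    (hd : ∀ z, u z = fderiv ℝ q z 1 - fderiv ℝ p z Complex.I)
    (hpC : ∀ z, |p z| ≤ C * √(u z)) (hqC : ∀ z, |q z| ≤ C * √(u z))
    (hφ : ContDiff ℝ 1 φ) (hφc : HasCompactSupport φ) (hφ0 : ∀ z, 0 ≤ φ z)
    (hA : MeasurableSet A) (hAfin : volume A ≠ ⊤) (hB : 0 ≤ B)
    (hφB : ∀ z, ‖fderiv ℝ φ z‖ ≤ A.indicator (fun _ => B) z) (hδ : 0 < δ) :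
    ∫ z, φ z ^ 2 * u z ≤ δ * (∫ z in A, φ z ^ 2 * u z) +
      4 * C ^ 2 * B ^ 2 / δ * volume.real A := by
  have hφ2 : ContDiff ℝ 1 (fun z => φ z ^ 2) := hφ.pow 2
  have hφ2c : HasCompactSupport (fun z => φ z ^ 2) := by
    have : (fun z => φ z ^ 2) = φ * φ := by funext z; simp [sq]
    rw [this]; exact hφc.mul_right
  have hcd : ∀ {f : ℂ → ℝ}, ContDiff ℝ 1 f → ∀ v, Continuous fun z => fderiv ℝ f z v :=
    fun hf v => (hf.continuous_fderiv (by simp)).clm_apply continuous_const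
  have hint : ∀ {f g : ℂ → ℝ}, Continuous f → HasCompactSupport f → Continuous g →
      Integrable (fun z => f z * g z) := fun hf hfc hg =>
    (hf.mul hg).integrable_of_hasCompactSupport hfc.mul_right
  have hcs : ∀ v, HasCompactSupport (fun z => fderiv ℝ (fun z => φ z ^ 2) z v) :=
    fun v => hφ2c.fderiv_apply ℝ v
  have parts : ∀ {g : ℂ → ℝ}, ContDiff ℝ 1 g → ∀ v,
      ∫ z, φ z ^ 2 * fderiv ℝ g z v = - ∫ z, fderiv ℝ (fun z => φ z ^ 2) z v * g z := by
    intro g hg v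
    exact integral_mul_fderiv_eq_neg_fderiv_mul_of_integrable
      (hint (hcd hφ2 v) (hcs v) hg.continuous) (hint hφ2.continuous hφ2c (hcd hg v))
      (hint hφ2.continuous hφ2c hg.continuous)
      (fun z _ => hφ2.differentiable (by simp) z) (fun z _ => hg.differentiable (by simp) z)
  have huc : Continuous u := by
    have : u = fun z => fderiv ℝ q z 1 - fderiv ℝ p z Complex.I := funext hd
    rw [this]; exact (hcd hq 1).sub (hcd hp _)
  have hI : Integrable (fun z => φ z ^ 2 * u z) := hint hφ2.continuous hφ2c huc
  -- Stokes for `φ² θ`: the derivatives move from `θ` onto the compactly supported `φ²`.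
  have e1 : ∫ z, φ z ^ 2 * u z = ∫ z, (fderiv ℝ (fun z => φ z ^ 2) z Complex.I * p z -
      fderiv ℝ (fun z => φ z ^ 2) z 1 * q z) := by
    simp only [hd, mul_sub]
    rw [integral_sub (hint hφ2.continuous hφ2c (hcd hq _)) (hint hφ2.continuous hφ2c (hcd hp _)),
      integral_sub (hint (hcd hφ2 _) (hcs _) hp.continuous)
        (hint (hcd hφ2 _) (hcs _) hq.continuous), parts hq, parts hp]
    ring
  have hconst : IntegrableOn (fun _ : ℂ => 4 * C ^ 2 * B ^ 2 / δ) A :=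
    integrableOn_const hAfin
  have e2 : ∫ z, A.indicator (fun z => δ * (φ z ^ 2 * u z) + 4 * C ^ 2 * B ^ 2 / δ) z =
      δ * (∫ z in A, φ z ^ 2 * u z) + 4 * C ^ 2 * B ^ 2 / δ * volume.real A := by
    rw [integral_indicator hA, integral_add (hI.const_mul δ).integrableOn hconst,
      integral_const_mul, setIntegral_const, smul_eq_mul, mul_comm (volume.real A)]
  rw [e1, ← e2]
  refine integral_mono ((hint (hcd hφ2 _) (hcs _) hp.continuous).sub
        (hint (hcd hφ2 _) (hcs _) hq.continuous))
    (((hI.const_mul δ).integrableOn.add hconst).integrable_indicator hA) fun z => ?_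
  have hder : ∀ v, fderiv ℝ (fun z => φ z ^ 2) z v = 2 * φ z * fderiv ℝ φ z v := by
    intro v
    rw [fderiv_fun_pow 2 (hφ.differentiable (by simp) z)]
    simp
  have hb : ∀ v : ℂ, ‖v‖ = 1 → |fderiv ℝ φ z v| ≤ A.indicator (fun _ => B) z := fun v hv => by
    have := (fderiv ℝ φ z).le_opNorm v
    rw [hv, mul_one] at this
    exact this.trans (hφB z)
  have h1 := hb 1 (by simp)
  have h2 := hb Complex.I (by simp)
  simp only [hder]
  by_cases hz : z ∈ A
  · rw [indicator_of_mem hz] at h1 h2 ⊢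
    have hs : √(u z) ^ 2 = u z := Real.sq_sqrt (hu z)
    have k1 : fderiv ℝ φ z Complex.I * p z ≤ B * (C * √(u z)) :=
      (le_abs_self _).trans (by rw [abs_mul]; exact mul_le_mul h2 (hpC z) (abs_nonneg _) hB)
    have k2 : -(fderiv ℝ φ z 1 * q z) ≤ B * (C * √(u z)) :=
      (neg_le_abs _).trans (by rw [abs_mul]; exact mul_le_mul h1 (hqC z) (abs_nonneg _) hB)
    -- Young's inequality with parameter `δ`. The factor 4 comes from `d(φ²) = 2φ dφ` and the two
    -- coefficients of `θ`. Both resulting terms are charged to `A` alone, which is what later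
    -- allows `δ` to be large.
    have k3 : 4 * (φ z * (B * (C * √(u z)))) ≤
        δ * (φ z ^ 2 * u z) + 4 * C ^ 2 * B ^ 2 / δ := by
      have : δ * (φ z ^ 2 * u z) + 4 * C ^ 2 * B ^ 2 / δ - 4 * (φ z * (B * (C * √(u z)))) =
          (δ * φ z * √(u z) - 2 * C * B) ^ 2 / δ := by
        rw [← hs, Real.sqrt_sq (Real.sqrt_nonneg _)]; field_simp; ring
      have h0 : 0 ≤ (δ * φ z * √(u z) - 2 * C * B) ^ 2 / δ := by positivity
      linarith
    have k4 := mul_le_mul_of_nonneg_left (add_le_add k1 k2) (hφ0 z)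
    linarith
  · rw [indicator_of_notMem hz] at h1 h2 ⊢
    rw [abs_nonpos_iff.1 h1, abs_nonpos_iff.1 h2]
    simp

/-- Cutoff functions at every scale on the plane with uniformly bounded Dirichlet energy. -/
theorem exists_cutoff : ∃ M : ℝ, 0 ≤ M ∧ ∀ R : ℝ, 0 < R → ∃ φ : ℂ → ℝ, ContDiff ℝ 1 φ ∧
    HasCompactSupport φ ∧ (∀ z, 0 ≤ φ z) ∧ (∀ z, φ z ≤ 1) ∧
    (∀ z ∈ Metric.ball (0 : ℂ) R, φ z = 1) ∧
    ∀ z, ‖fderiv ℝ φ z‖ ≤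
      (Metric.closedBall (0 : ℂ) (2 * R) \ Metric.ball 0 R).indicator (fun _ => M / R) z := by
  let χ : ContDiffBump (0 : ℂ) := ⟨1, 2, one_pos, one_lt_two⟩
  have hχ : ContDiff ℝ 1 χ := χ.contDiff
  obtain ⟨M, hM⟩ := (hχ.continuous_fderiv (by simp)).bounded_above_of_compact_support
    (χ.hasCompactSupport.fderiv ℝ)
  refine ⟨M, (norm_nonneg _).trans (hM 0), fun R hR => ?_⟩
  have hne : R⁻¹ ≠ 0 := (inv_pos.2 hR).ne'
  have hone : ∀ z ∈ Metric.ball (0 : ℂ) R, χ (R⁻¹ • z) = 1 := fun z hz => by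
    refine χ.one_of_mem_closedBall ?_
    rw [mem_ball_zero_iff] at hz
    rw [mem_closedBall_zero_iff, norm_smul, Real.norm_of_nonneg (inv_pos.2 hR).le,
      inv_mul_le_iff₀ hR]
    simpa [χ] using hz.le
  -- One fixed bump is rescaled: its gradient scales as `1 / R`, while the area of the annulus
  -- scales as `R²`.
  refine ⟨fun z => χ (R⁻¹ • z), hχ.comp (contDiff_const_smul _),
    χ.hasCompactSupport.comp_smul hne, fun z => χ.nonneg, fun z => χ.le_one, hone, fun z => ?_⟩
  by_cases hz : z ∈ Metric.closedBall (0 : ℂ) (2 * R) \ Metric.ball 0 R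
  · rw [indicator_of_mem hz]
    have hc := fderiv_comp_smul (𝕜 := ℝ) (f := χ) (x := z) (c := R⁻¹)
    rw [hc, norm_smul, Real.norm_of_nonneg (inv_pos.2 hR).le, div_eq_inv_mul]
    exact mul_le_mul_of_nonneg_left (hM _) (inv_pos.2 hR).le
  · rw [indicator_of_notMem hz]
    refine (norm_eq_zero.2 ?_).le
    by_cases hb : z ∈ Metric.ball (0 : ℂ) R
    · have : (fun z => χ (R⁻¹ • z)) =ᶠ[𝓝 z] fun _ => 1 := by
        filter_upwards [Metric.isOpen_ball.mem_nhds hb] with w hw using hone w hw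
      rw [this.fderiv_eq]; simp
    · have hz' : z ∉ Metric.closedBall (0 : ℂ) (2 * R) := fun h => hz ⟨h, hb⟩
      have : (fun z => χ (R⁻¹ • z)) =ᶠ[𝓝 z] fun _ => 0 := by
        filter_upwards [Metric.isClosed_closedBall.isOpen_compl.mem_nhds hz'] with w hw
        refine χ.zero_of_le_dist ?_
        rw [mem_compl_iff, mem_closedBall_zero_iff, not_le] at hw
        rw [dist_zero_right, norm_smul, Real.norm_of_nonneg (inv_pos.2 hR).le,
          le_inv_mul_iff₀ hR]
        simpa [χ, mul_comm] using hw.le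
      rw [this.fderiv_eq]; simp

/-- The energy inequality at scale `R`. -/
theorem exists_energy_le {p q u : ℂ → ℝ} {C : ℝ}
    (hp : ContDiff ℝ 1 p) (hq : ContDiff ℝ 1 q) (huc : Continuous u) (hu : ∀ z, 0 ≤ u z)
    (hd : ∀ z, u z = fderiv ℝ q z 1 - fderiv ℝ p z Complex.I)
    (hpC : ∀ z, |p z| ≤ C * √(u z)) (hqC : ∀ z, |q z| ≤ C * √(u z)) :
    ∃ K : ℝ, ∀ R : ℝ, 0 < R → ∃ φ : ℂ → ℝ, (∀ z, 0 ≤ φ z) ∧ (∀ z, φ z ≤ 1) ∧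
      Integrable (fun z => φ z ^ 2 * u z) ∧
      (∫ z in Metric.ball 0 R, u z) ≤ ∫ z, φ z ^ 2 * u z ∧
      ∀ δ, 0 < δ → ∫ z, φ z ^ 2 * u z ≤
        δ * (∫ z in Metric.closedBall (0 : ℂ) (2 * R) \ Metric.ball 0 R, φ z ^ 2 * u z) +
          K / δ := by
  obtain ⟨M, hM, hcut⟩ := exists_cutoff
  -- This is `4 C² B²` with `B = M / R`, times the area bound `4 π R²`; the radius cancels.
  refine ⟨16 * C ^ 2 * M ^ 2 * Real.pi, fun R hR => ?_⟩
  obtain ⟨φ, h1, h2, h3, h4, h5, h6⟩ := hcut R hR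
  have hs : HasCompactSupport (fun z => φ z ^ 2 * u z) := by
    have : (fun z => φ z ^ 2 * u z) = φ * (φ * u) := by
      funext z; simp only [Pi.mul_apply]; ring
    rw [this]; exact h2.mul_right
  have hI : Integrable (fun z => φ z ^ 2 * u z) :=
    ((h1.continuous.pow 2).mul huc).integrable_of_hasCompactSupport hs
  refine ⟨φ, h3, h4, hI, ?_, fun δ hδ => ?_⟩
  · have hcongr : ∫ z in Metric.ball 0 R, u z = ∫ z in Metric.ball 0 R, φ z ^ 2 * u z :=
      setIntegral_congr_fun Metric.isOpen_ball.measurableSet fun z hz => by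
        rw [h5 z hz, one_pow, one_mul]
    rw [hcongr]
    exact setIntegral_le_integral hI (Eventually.of_forall fun z =>
      mul_nonneg (sq_nonneg _) (hu z))
  · have hfin : volume (Metric.closedBall (0 : ℂ) (2 * R)) ≠ ⊤ := measure_closedBall_lt_top.ne
    have hvol : volume.real (Metric.closedBall (0 : ℂ) (2 * R) \ Metric.ball 0 R) ≤
        4 * R ^ 2 * Real.pi := by
      refine (measureReal_mono sdiff_subset hfin).trans_eq ?_
      rw [Measure.real, Complex.volume_closedBall]
      simp [ENNReal.toReal_ofReal hR.le]
      ring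
    refine (integral_sq_mul_le_of_primitive_le hp hq hu hd hpC hqC h1 h2 h3
      (Metric.isClosed_closedBall.measurableSet.diff Metric.isOpen_ball.measurableSet)
      (measure_ne_top_of_subset sdiff_subset hfin) (div_nonneg hM hR.le) h6 hδ).trans ?_
    refine add_le_add le_rfl ((mul_le_mul_of_nonneg_left hvol (by positivity)).trans_eq ?_)
    field_simp
    ring

/-- A nonnegative two-form on the plane with a primitive bounded by its square root vanishes. -/
theorem eq_zero_of_primitive_le {p q u : ℂ → ℝ} {C : ℝ}
    (hp : ContDiff ℝ 1 p) (hq : ContDiff ℝ 1 q) (hu : ∀ z, 0 ≤ u z)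
    (hd : ∀ z, u z = fderiv ℝ q z 1 - fderiv ℝ p z Complex.I)
    (hpC : ∀ z, |p z| ≤ C * √(u z)) (hqC : ∀ z, |q z| ≤ C * √(u z)) (z : ℂ) : u z = 0 := by
  have huc : Continuous u := by
    have : u = fun z => fderiv ℝ q z 1 - fderiv ℝ p z Complex.I := funext hd
    rw [this]
    exact ((hq.continuous_fderiv (by simp)).clm_apply continuous_const).sub
      ((hp.continuous_fderiv (by simp)).clm_apply continuous_const)
  obtain ⟨K, key⟩ := exists_energy_le hp hq huc hu hd hpC hqC
  have hcov : AECover (volume : Measure ℂ) atTop (fun R : ℝ => Metric.ball (0 : ℂ) R) :=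
    aecover_ball tendsto_id
  have hloc : ∀ R : ℝ, IntegrableOn u (Metric.ball (0 : ℂ) R) := fun R =>
    (huc.continuousOn.integrableOn_compact (isCompact_closedBall _ _)).mono_set
      Metric.ball_subset_closedBall
  -- With `δ = 1/2` the annulus term is absorbed into the left side, leaving the bound `4 K` on
  -- every disc.
  have hui : Integrable u := by
    refine hcov.integrable_of_integral_bounded_of_nonneg_ae (4 * K) hloc
      (Eventually.of_forall hu) ?_
    filter_upwards [eventually_gt_atTop 0] with R hR
    obtain ⟨φ, h1, h2, h3, h4, h5⟩ := key R hR
    have h6 := h5 (1 / 2) (by norm_num)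
    have h7 : (∫ z in Metric.closedBall (0 : ℂ) (2 * R) \ Metric.ball 0 R, φ z ^ 2 * u z) ≤
        ∫ z, φ z ^ 2 * u z := setIntegral_le_integral h3 (Eventually.of_forall fun z =>
        mul_nonneg (sq_nonneg _) (hu z))
    have h8 : K / (1 / 2) = 2 * K := by ring
    linarith
  have hlim := hcov.integral_tendsto_of_countably_generated hui
  -- Once `u` is integrable, the annulus term is at most a tail of its integral and disappears as `R
  -- → ∞` for each fixed `δ`. Then `δ → ∞` gives integral zero.
  have hle : ∀ δ, 0 < δ → ∫ z, u z ≤ K / δ := by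
    intro δ hδ
    have hb : ∀ᶠ R : ℝ in atTop, ∫ z in Metric.ball (0 : ℂ) R, u z ≤
        δ * ((∫ z, u z) - ∫ z in Metric.ball (0 : ℂ) R, u z) + K / δ := by
      filter_upwards [eventually_gt_atTop 0] with R hR
      obtain ⟨φ, h1, h2, h3, h4, h5⟩ := key R hR
      have hmeas := (Metric.isClosed_closedBall (x := (0 : ℂ)) (ε := 2 * R)).measurableSet.diff
        (Metric.isOpen_ball (x := (0 : ℂ)) (ε := R)).measurableSet
      have h6 : (∫ z in Metric.closedBall (0 : ℂ) (2 * R) \ Metric.ball 0 R, φ z ^ 2 * u z) ≤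
          (∫ z, u z) - ∫ z in Metric.ball (0 : ℂ) R, u z := by
        rw [← integral_add_compl (Metric.isOpen_ball (x := (0 : ℂ)) (ε := R)).measurableSet hui,
          add_sub_cancel_left]
        refine (setIntegral_mono (g := u) h3.integrableOn hui.integrableOn fun z => ?_).trans
          (setIntegral_mono_set hui.integrableOn (Eventually.of_forall hu)
            (Eventually.of_forall fun z hz => hz.2))
        exact mul_le_of_le_one_left (hu z) (pow_le_one₀ (h1 z) (h2 z))
      exact h4.trans ((h5 δ hδ).trans
        (add_le_add (mul_le_mul_of_nonneg_left h6 hδ.le) le_rfl))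
    have := le_of_tendsto_of_tendsto hlim
      (((tendsto_const_nhds.sub hlim).const_mul δ).add_const (K / δ)) hb
    simpa using this
  have hzero : ∫ z, u z = 0 := by
    refine le_antisymm ?_ (integral_nonneg hu)
    exact ge_of_tendsto (tendsto_const_nhds.div_atTop tendsto_id)
      ((eventually_gt_atTop 0).mono hle)
  rw [integral_eq_zero_iff_of_nonneg hu hui] at hzero
  exact congrFun ((huc.ae_eq_iff_eq volume continuous_zero).1 hzero) z

end Plane

end DiffForm

namespace DiffForm

/-! ### Continuity and compactness on the tangent bundle. -/

section TangentBundle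
open Bundle
variable {E : Type*} [NormedAddCommGroup E] [NormedSpace ℝ E]
  {X : Type*} [TopologicalSpace X] [ChartedSpace E X] [IsManifold 𝓘(ℝ, E) ∞ X] {k : ℕ}

/-- A form is the pullback along a chart of its expression in that chart. -/
theorem rawForm_eq_inChart (α : RawForm E X k) {x₀ x : X} (hx : x ∈ (chartAt E x₀).source) :
    α x = (inChart x₀ α (chartAt E x₀ x)).compContinuousLinearMap
      (mfderiv 𝓘(ℝ, E) 𝓘(ℝ, E) (chartAt E x₀) x) := by
  have h1 := rawPullback_comp (h := chartAt E x₀) (f := (chartAt E x₀).symm) (y := x)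
    ((mdiffAt_chart_symm ((chartAt E x₀).map_source hx)).mdifferentiableAt (by simp))
    ((mdiffAt_chart hx).mdifferentiableAt (by simp)) α
  have h2 : (chartAt E x₀).symm ∘ chartAt E x₀ =ᶠ[𝓝 x] id := by
    filter_upwards [(chartAt E x₀).open_source.mem_nhds hx] with z hz
    exact (chartAt E x₀).left_inv hz
  rw [rawPullback_congr h2 α] at h1
  have h3 : rawPullback E E (id : X → X) α x = α x := by
    simp only [rawPullback, mfderiv_id]
    rfl
  rw [← h3, ← h1]
  rfl

/-- Links the differentials used to define forms with the trivializations used to define the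
topology of the tangent bundle. -/
theorem mfderiv_chartAt_apply {x₀ x : X} (hx : x ∈ (chartAt E x₀).source)
    (v : TangentSpace 𝓘(ℝ, E) x) :
    mfderiv 𝓘(ℝ, E) 𝓘(ℝ, E) (chartAt E x₀) x v =
      (trivializationAt E (TangentSpace 𝓘(ℝ, E)) x₀ ⟨x, v⟩).2 := by
  have h := TangentBundle.continuousLinearMapAt_trivializationAt (I := 𝓘(ℝ, E)) hx
  have h2 := congrArg (fun L => L v) h
  rw [Trivialization.continuousLinearMapAt_apply, Trivialization.linearMapAt_apply,
    if_pos (by exact hx)] at h2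
  exact h2.symm

/-- Evaluating a smooth form on continuous families of tangent vectors is continuous. -/
theorem continuous_form_apply (α : Form E X k) {T : Type*} [TopologicalSpace T] {b : T → X}
    (hb : Continuous b) (v : ∀ t, Fin k → TangentSpace 𝓘(ℝ, E) (b t))
    (hv : ∀ i, Continuous fun t => (⟨b t, v t i⟩ : TangentBundle 𝓘(ℝ, E) X)) :
    Continuous fun t => α.1 (b t) (v t) := by
  refine continuous_iff_continuousAt.2 fun t₀ => ?_
  set e := trivializationAt E (TangentSpace 𝓘(ℝ, E)) (b t₀) with he
  have hsrc : (chartAt E (b t₀)).source ∈ 𝓝 (b t₀) :=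
    (chartAt E (b t₀)).open_source.mem_nhds (mem_chart_source E _)
  -- Near `t₀` the form and all the vectors are written in the one chart at `b t₀`, so everything
  -- takes values in fixed normed spaces.
  have hev : (fun t => α.1 (b t) (v t)) =ᶠ[𝓝 t₀] fun t =>
      (inChart (b t₀) α.1 (chartAt E (b t₀) (b t))).toContinuousMultilinearMap
        (fun i => (e ⟨b t, v t i⟩).2) := by
    filter_upwards [hb.continuousAt.preimage_mem_nhds hsrc] with t ht
    rw [rawForm_eq_inChart α.1 ht]
    change (inChart (b t₀) α.1 (chartAt E (b t₀) (b t)))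
      (fun i => mfderiv 𝓘(ℝ, E) 𝓘(ℝ, E) (chartAt E (b t₀)) (b t) (v t i)) = _
    simp only [mfderiv_chartAt_apply ht]
    rfl
  refine ContinuousAt.congr ?_ hev.symm
  have h1 : ContinuousAt (fun t => inChart (b t₀) α.1 (chartAt E (b t₀) (b t))) t₀ := by
    refine ContinuousAt.comp (g := inChart (b t₀) α.1) ?_ (ContinuousAt.comp
      (g := chartAt E (b t₀)) ?_ hb.continuousAt)
    · exact ((α.2 (b t₀)).contDiffAt ((chartAt E _).open_target.mem_nhds
        ((chartAt E _).map_source (mem_chart_source E _)))).continuousAt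
    · exact (chartAt E (b t₀)).continuousAt (mem_chart_source E _)
  have h2 : ContinuousAt (fun t => fun i => (e ⟨b t, v t i⟩).2) t₀ := by
    refine continuousAt_pi.2 fun i => ?_
    have : ContinuousAt e ⟨b t₀, v t₀ i⟩ := e.toOpenPartialHomeomorph.continuousAt (by
      rw [Trivialization.mem_source]; exact mem_chart_source E _)
    exact (ContinuousAt.comp (g := e)
      (f := fun t => (⟨b t, v t i⟩ : TangentBundle 𝓘(ℝ, E) X)) this (hv i).continuousAt).snd
  exact ((ContinuousAlternatingMap.toContinuousMultilinearMapCLM ℝ).continuous.continuousAt.comp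
    h1).eval h2

theorem continuous_metric_apply
    (g : ContMDiffRiemannianMetric 𝓘(ℝ, E) ∞ E (fun x : X => TangentSpace 𝓘(ℝ, E) x)) :
    Continuous fun p : TangentBundle 𝓘(ℝ, E) X => g.inner p.1 p.2 p.2 := by
  have h := Continuous.clm_bundle_apply₂ (F₁ := E) (F₂ := E) (F₃ := ℝ)
    (E₁ := fun x : X => TangentSpace 𝓘(ℝ, E) x) (E₂ := fun x : X => TangentSpace 𝓘(ℝ, E) x)
    (E₃ := Bundle.Trivial X ℝ) (b := fun p : TangentBundle 𝓘(ℝ, E) X => p.1)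
    (ψ := fun p => g.inner p.1) (v := fun p => p.2) (w := fun p => p.2)
    (g.contMDiff.continuous.comp (FiberBundle.continuous_proj E _)) continuous_id continuous_id
  -- The metric takes values in the trivial line bundle; its real coordinate is extracted here.
  have h2 := (Bundle.Trivial.homeomorphProd X ℝ).continuous.comp h
  exact h2.snd

theorem AlmostComplexStructure.continuous_apply (J : AlmostComplexStructure E X) :
    Continuous fun p : TangentBundle 𝓘(ℝ, E) X =>
      (⟨p.1, J.toFun p.1 p.2⟩ : TangentBundle 𝓘(ℝ, E) X) :=
  Continuous.clm_bundle_apply (F₁ := E) (F₂ := E)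
    (E₁ := fun x : X => TangentSpace 𝓘(ℝ, E) x) (E₂ := fun x : X => TangentSpace 𝓘(ℝ, E) x)
    (b := fun p : TangentBundle 𝓘(ℝ, E) X => p.1) (ϕ := fun p => J.toFun p.1)
    (v := fun p => p.2)
    (J.smooth.continuous.comp (FiberBundle.continuous_proj E _)) continuous_id

theorem continuous_energy (Ω : Form E X 2) (J : AlmostComplexStructure E X) :
    Continuous fun p : TangentBundle 𝓘(ℝ, E) X => Ω.1 p.1 ![p.2, J.toFun p.1 p.2] := by
  refine continuous_form_apply Ω (FiberBundle.continuous_proj E _) _ fun i => ?_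
  fin_cases i
  · exact continuous_id
  · exact J.continuous_apply

/-- On a compact manifold, a continuous function on the tangent bundle that is homogeneous of
degree two is bounded by any positive one. -/
theorem exists_le_mul_of_homogeneous [FiniteDimensional ℝ E] [CompactSpace X]
    {P Q : TangentBundle 𝓘(ℝ, E) X → ℝ} (hP : Continuous P) (hQ : Continuous Q)
    (hPh : ∀ (x : X) (c : ℝ) (v : TangentSpace 𝓘(ℝ, E) x), P ⟨x, c • v⟩ = c ^ 2 * P ⟨x, v⟩)
    (hQh : ∀ (x : X) (c : ℝ) (v : TangentSpace 𝓘(ℝ, E) x), Q ⟨x, c • v⟩ = c ^ 2 * Q ⟨x, v⟩)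
    (hpos : ∀ (x : X) (v : TangentSpace 𝓘(ℝ, E) x), v ≠ 0 → 0 < Q ⟨x, v⟩) :
    ∃ C : ℝ, 0 ≤ C ∧ ∀ p, P p ≤ C * Q p := by
  have hzero : ∀ {R : TangentBundle 𝓘(ℝ, E) X → ℝ}, (∀ (x : X) (c : ℝ)
      (v : TangentSpace 𝓘(ℝ, E) x), R ⟨x, c • v⟩ = c ^ 2 * R ⟨x, v⟩) →
      ∀ x, R ⟨x, (0 : TangentSpace 𝓘(ℝ, E) x)⟩ = 0 := fun hR x => by
    simpa using hR x 0 0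
  have hQ0 : ∀ p, 0 ≤ Q p := fun ⟨x, v⟩ => by
    by_cases hv : v = 0
    · rw [hv, hzero hQh]
    · exact (hpos x v hv).le
  suffices h : ∃ C : ℝ, 0 ≤ C ∧ ∀ x ∈ (univ : Set X), ∀ v : TangentSpace 𝓘(ℝ, E) x,
      P ⟨x, v⟩ ≤ C * Q ⟨x, v⟩ by
    obtain ⟨C, hC, h⟩ := h
    exact ⟨C, hC, fun p => h p.1 trivial p.2⟩
  -- The property passes to subsets and finite unions, so it only has to hold near each point.
  refine isCompact_univ.induction_on (p := fun s => ∃ C : ℝ, 0 ≤ C ∧ ∀ x ∈ s,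
      ∀ v : TangentSpace 𝓘(ℝ, E) x, P ⟨x, v⟩ ≤ C * Q ⟨x, v⟩) ⟨0, le_rfl, by simp⟩
    (fun s t hst ⟨C, hC, h⟩ => ⟨C, hC, fun x hx => h x (hst hx)⟩) ?_ ?_
  · rintro s t ⟨C, hC, h⟩ ⟨C', hC', h'⟩
    refine ⟨C + C', add_nonneg hC hC', fun x hx v => ?_⟩
    have hq := hQ0 ⟨x, v⟩
    rcases hx with hx | hx
    · exact (h x hx v).trans (mul_le_mul_of_nonneg_right (by linarith) hq)
    · exact (h' x hx v).trans (mul_le_mul_of_nonneg_right (by linarith) hq)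
  · intro x₀ _
    set e := trivializationAt E (TangentSpace 𝓘(ℝ, E)) x₀ with he
    have hbase : e.baseSet ∈ 𝓝 x₀ := e.open_baseSet.mem_nhds (mem_baseSet_trivializationAt E _ x₀)
    have hx₀ := mem_of_mem_nhds hbase
    let Ψ : X × E → TangentBundle 𝓘(ℝ, E) X := fun z => ⟨z.1, e.symm z.1 z.2⟩
    have hΨ : ∀ w, ContinuousAt Ψ (x₀, w) := fun w =>
      (e.continuousOn_symm).continuousAt (prod_mem_nhds hbase univ_mem)
    have hne : ∀ x ∈ e.baseSet, ∀ w : E, w ≠ 0 → e.symm x w ≠ 0 := fun x hx w hw h0 => by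
      have := e.apply_mk_symm hx w
      rw [h0] at this
      have h1 : (e.continuousLinearMapAt ℝ x) 0 = w := by
        rw [Trivialization.continuousLinearMapAt_apply,
          Trivialization.linearMapAt_apply, if_pos hx, this]
      exact hw (by simpa using h1.symm)
    have hS : IsCompact (Metric.sphere (0 : E) 1) := isCompact_sphere 0 1
    have hSne : ∀ w ∈ Metric.sphere (0 : E) 1, w ≠ 0 := fun w hw h0 => by
      simp [h0] at hw
    have hcont : ∀ {R : TangentBundle 𝓘(ℝ, E) X → ℝ}, Continuous R →
        Continuous fun w => R (Ψ (x₀, w)) := fun hR => continuous_iff_continuousAt.2 fun w =>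
      hR.continuousAt.comp ((hΨ w).comp (f := fun w => (x₀, w)) (by fun_prop))
    obtain ⟨C, hC⟩ := hS.exists_bound_of_continuousOn (f := fun w => P (Ψ (x₀, w)) / Q (Ψ (x₀, w)))
      ((hcont hP).continuousOn.div (hcont hQ).continuousOn
        fun w hw => (hpos _ _ (hne x₀ hx₀ w (hSne w hw))).ne')
    -- Adding 1 to `|C|` makes the inequality strict, hence open; compactness of the model sphere
    -- then gives a neighbourhood of `x₀` valid for all `w`.
    have hev : ∀ᶠ x in 𝓝 x₀, ∀ w ∈ Metric.sphere (0 : E) 1,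
        P (Ψ (x, w)) < (|C| + 1) * Q (Ψ (x, w)) := by
      refine hS.eventually_forall_of_forall_eventually fun w hw => ?_
      refine ((hP.continuousAt.comp (hΨ w)).eventually_lt
        (continuousAt_const.mul (hQ.continuousAt.comp (hΨ w))) ?_)
      have hq := hpos _ _ (hne x₀ hx₀ w (hSne w hw))
      have h1 := (le_abs_self _).trans (hC w hw)
      rw [div_le_iff₀ hq] at h1
      refine h1.trans_lt (mul_lt_mul_of_pos_right ?_ hq)
      linarith [le_abs_self C]
    refine ⟨_, mem_nhdsWithin_of_mem_nhds (inter_mem hbase hev), |C| + 1, by positivity,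
      fun x hx v => ?_⟩
    by_cases hv : v = 0
    · rw [hv, hzero hPh, hzero hQh, mul_zero]
    · set w : E := (e ⟨x, v⟩).2 with hw
      have hsymm : e.symm x w = v := e.symm_apply_apply_mk hx.1 v
      have hw0 : w ≠ 0 := fun h0 => hv (by
        rw [← hsymm, h0, ← Trivialization.symmL_apply (R := ℝ) e hx.1, map_zero])
      have hn : ‖w‖ ≠ 0 := norm_ne_zero_iff.2 hw0
      -- Homogeneity reduces an arbitrary vector to one whose coordinates lie on the unit sphere.
      have hs := hx.2 (‖w‖⁻¹ • w) (by
        rw [mem_sphere_zero_iff_norm, norm_smul, norm_inv, norm_norm, inv_mul_cancel₀ hn])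
      have h1 : e.symm x (‖w‖⁻¹ • w) = ‖w‖⁻¹ • v := by
        rw [← Trivialization.symmL_apply (R := ℝ) e hx.1, map_smul,
          Trivialization.symmL_apply (R := ℝ) e hx.1, hsymm]
      simp only [Ψ, h1, hPh, hQh] at hs
      have h2 : 0 < ‖w‖⁻¹ ^ 2 := by positivity
      have h3 : ‖w‖⁻¹ ^ 2 * P ⟨x, v⟩ ≤ ‖w‖⁻¹ ^ 2 * ((|C| + 1) * Q ⟨x, v⟩) := by linarith
      exact le_of_mul_le_mul_left h3 h2

end TangentBundle

/-! ### Maps with vanishing differential. -/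

section Const
variable {E : Type*} [NormedAddCommGroup E] [NormedSpace ℝ E]
  {X : Type*} [TopologicalSpace X] [ChartedSpace E X] [IsManifold 𝓘(ℝ, E) ∞ X]
  {V : Type*} [NormedAddCommGroup V] [NormedSpace ℝ V]

/-- On a small ball `f` stays in one chart, where a zero derivative makes it constant; connectedness
of `V` turns locally constant into constant. -/
theorem eq_of_mfderiv_eq_zero {f : V → X} (hf : ContMDiff 𝓘(ℝ, V) 𝓘(ℝ, E) ∞ f)
    (h : ∀ z, mfderiv 𝓘(ℝ, V) 𝓘(ℝ, E) f z = 0) (z w : V) : f z = f w := by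
  refine IsLocallyConstant.apply_eq_of_preconnectedSpace
    ((IsLocallyConstant.iff_eventually_eq f).2 fun z => ?_) z w
  have hs : f ⁻¹' (chartAt E (f z)).source ∈ 𝓝 z := hf.continuous.continuousAt.preimage_mem_nhds
    ((chartAt E (f z)).open_source.mem_nhds (mem_chart_source E _))
  obtain ⟨r, hr, hball⟩ := Metric.mem_nhds_iff.1 hs
  have hd : ∀ y ∈ Metric.ball z r, HasFDerivAt (chartAt E (f z) ∘ f) (0 : V →L[ℝ] E) y := by
    intro y hy
    have h1 := (mdiffAt_chart (hball hy)).mdifferentiableAt (by simp)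
    have h2 := hf.mdifferentiable (by simp) y
    have h3 := (h1.comp y h2).differentiableAt.hasFDerivAt
    rwa [← mfderiv_eq_fderiv, mfderiv_comp y h1 h2, h y, ContinuousLinearMap.comp_zero] at h3
  filter_upwards [Metric.ball_mem_nhds z hr] with y hy
  have h4 := Metric.isOpen_ball.is_const_of_fderiv_eq_zero
    (convex_ball z r).isPreconnected
    (fun y hy => (hd y hy).differentiableAt.differentiableWithinAt)
    (fun y hy => (hd y hy).fderiv) hy (Metric.mem_ball_self hr)
  exact (chartAt E (f z)).injOn (hball hy) (mem_chart_source E _) h4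

end Const

end DiffForm

namespace DiffForm

/-! ### Representing the symplectic class through `Y`. -/

section Pullback
variable {E : Type*} [NormedAddCommGroup E] [NormedSpace ℝ E]
  {E' : Type*} [NormedAddCommGroup E'] [NormedSpace ℝ E']
  {E'' : Type*} [NormedAddCommGroup E''] [NormedSpace ℝ E'']
  {X : Type*} [TopologicalSpace X] [ChartedSpace E X] [IsManifold 𝓘(ℝ, E) ∞ X]
  {X' : Type*} [TopologicalSpace X'] [ChartedSpace E' X'] [IsManifold 𝓘(ℝ, E') ∞ X']
  {X'' : Type*} [TopologicalSpace X''] [ChartedSpace E'' X''] [IsManifold 𝓘(ℝ, E'') ∞ X'']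

theorem pullback_comp (f : C^∞⟮𝓘(ℝ, E'), X'; 𝓘(ℝ, E''), X''⟯) (h : C^∞⟮𝓘(ℝ, E), X; 𝓘(ℝ, E'), X'⟯)
    (k : ℕ) (α : Form E'' X'' k) : pullback (f.comp h) k α = pullback h k (pullback f k α) :=
  Subtype.ext (funext fun x => (rawPullback_comp (f.contMDiff.mdifferentiable (by simp) _)
    (h.contMDiff.mdifferentiable (by simp) _) α.1).symm)

/-- A class in the image of `(f₂ ∘ f₁)^*` is represented, up to an exact form, by the pullback
along `f₁` of any representative of a class pulled back along `f₂`. -/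
theorem exists_eq_pullback_add_d (f₁ : C^∞⟮𝓘(ℝ, E), X; 𝓘(ℝ, E'), X'⟯)
    (f₂ : C^∞⟮𝓘(ℝ, E'), X'; 𝓘(ℝ, E''), X''⟯) {P : Form E' X' 2 → Prop}
    (hP : ∀ c : DeRhamCohomology E' X' 2, ∃ (α : Form E' X' 2) (hα : d α = 0),
      deRhamClass α hα = c ∧ P α)
    {Ω : Form E X 2} (hΩ : d Ω = 0)
    (hmem : deRhamClass Ω hΩ ∈ LinearMap.range (deRhamMap (f₂.comp f₁) 2)) :
    ∃ (α : Form E' X' 2) (η : Form E X 1), P α ∧ Ω = pullback f₁ 2 α + d η := by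
  obtain ⟨c, hc⟩ := hmem
  obtain ⟨⟨σ, hσ⟩, rfl⟩ := Submodule.Quotient.mk_surjective _ c
  -- The class to be represented on `Y` is `f₂^*[σ]`.
  obtain ⟨α, hα, hcl, hPα⟩ := hP (deRhamMap f₂ 2 (Submodule.Quotient.mk ⟨σ, hσ⟩))
  obtain ⟨κ, hκ⟩ : ∃ κ : Form E' X' 1, d κ = α - pullback f₂ 2 σ :=
    (Submodule.Quotient.eq _).1 hcl
  obtain ⟨ν, hν⟩ : ∃ ν : Form E X 1, d ν = pullback (f₂.comp f₁) 2 σ - Ω :=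
    (Submodule.Quotient.eq _).1 hc
  -- Solve `Ω = f₁^* f₂^* σ - dν` and `f₂^* σ = α - dκ` for `Ω`.
  refine ⟨α, -(pullback f₁ 1 κ) - ν, hPα, ?_⟩
  rw [map_sub, map_neg, d_pullback, hκ, hν, map_sub, pullback_comp]
  abel

end Pullback

/-! ### Lifting to the universal covering. -/

section Lift
universe u
variable {F : Type*} [NormedAddCommGroup F] [NormedSpace ℝ F]
  {Y : Type u} [TopologicalSpace Y] [ChartedSpace F Y]
  {V : Type*} [NormedAddCommGroup V] [NormedSpace ℝ V]

/-- Smooth maps from a vector space lift to the universal covering. -/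
theorem UniversalCovering.exists_lift (U : UniversalCovering F Y)
    (f : C^∞⟮𝓘(ℝ, V), V; 𝓘(ℝ, F), Y⟯) :
    ∃ h : C^∞⟮𝓘(ℝ, V), V; 𝓘(ℝ, F), U.carrier⟯, U.proj.comp h = f := by
  obtain ⟨e₀, he₀⟩ := U.surjective (f 0)
  obtain ⟨h, ⟨-, hh⟩, -⟩ := U.isCoveringMap.existsUnique_continuousMap_lifts
    (⟨f, f.contMDiff.continuous⟩ : C(V, Y)) 0 e₀ he₀
  have hproj : ∀ z, U.proj (h z) = f z := fun z => congrFun hh z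
  refine ⟨⟨h, fun z => ?_⟩, ?_⟩
  -- Covering theory gives only a continuous lift. Near `z` it equals a smooth local inverse of the
  -- projection composed with `f`.
  · have hloc := U.isLocalDiffeomorph (h z)
    have h1 := hloc.localInverse_contMDiffAt
    rw [hproj z] at h1
    refine (h1.comp z f.contMDiff.contMDiffAt).congr_of_eventuallyEq ?_
    filter_upwards [h.continuous.continuousAt.eventually
      hloc.localInverse_eventuallyEq_left] with w hw
    rw [Function.comp_apply, ← hproj w]
    exact hw.symm
  · ext z
    exact hproj z

end Lift

/-! ### Forms on the plane in coordinates. -/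

section Plane

/-- The preferred charts of `ℂ` are the identity. -/
theorem inChart_self (k : ℕ) (α : RawForm ℂ ℂ k) (z : ℂ) : inChart z α = onModel α := by
  funext w
  change (α w).compContinuousLinearMap (mfderiv 𝓘(ℝ, ℂ) 𝓘(ℝ, ℂ) (id : ℂ → ℂ) w) = α w
  rw [mfderiv_id]
  rfl

theorem contDiff_form_apply {k : ℕ} (α : Form ℂ ℂ k) (v : Fin k → ℂ) :
    ContDiff ℝ ∞ fun z => onModel α.1 z v := by
  have h := α.2 0
  rw [inChart_self] at h
  have h2 : ContDiff ℝ ∞ (onModel α.1) := contDiffOn_univ.1 h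
  exact (ContinuousAlternatingMap.apply ℝ ℂ ℝ v).contDiff.comp h2

/-- For `θ = p dx + q dy` this is `∂q/∂x - ∂p/∂y`, the form of primitive that
`eq_zero_of_primitive_le` expects. -/
theorem d_apply_plane (θ : Form ℂ ℂ 1) (z : ℂ) :
    onModel (d θ).1 z ![1, Complex.I] = fderiv ℝ (fun w => onModel θ.1 w ![Complex.I]) z 1 -
      fderiv ℝ (fun w => onModel θ.1 w ![1]) z Complex.I := by
  have hd : DifferentiableAt ℝ (onModel θ.1) z := by
    have h := differentiableAt_inChart θ z
    rwa [inChart_self] at h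
  have h1 : onModel (d θ).1 z = extDeriv (onModel θ.1) z := by
    change (extDeriv (inChart z θ.1) z).compContinuousLinearMap
      (mfderiv 𝓘(ℝ, ℂ) 𝓘(ℝ, ℂ) (id : ℂ → ℂ) z) = _
    rw [mfderiv_id, inChart_self]
    rfl
  have e0 : Fin.removeNth 0 ![(1 : ℂ), Complex.I] = ![Complex.I] := by
    ext i; fin_cases i; rfl
  have e1 : Fin.removeNth 1 ![(1 : ℂ), Complex.I] = ![1] := by
    ext i; fin_cases i; rfl
  rw [h1, extDeriv_apply hd, Fin.sum_univ_two, e0, e1]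
  simp [sub_eq_add_neg]

end Plane

/-! ### Constancy of `J`-holomorphic planes. -/

section Holomorphic
universe u
variable {E : Type*} [NormedAddCommGroup E] [NormedSpace ℝ E] [FiniteDimensional ℝ E]
  {X : Type*} [TopologicalSpace X] [CompactSpace X] [ChartedSpace E X]
  [IsManifold 𝓘(ℝ, E) ∞ X]
  {F : Type*} [NormedAddCommGroup F] [NormedSpace ℝ F]
  {Y : Type u} [TopologicalSpace Y] [ChartedSpace F Y] [IsManifold 𝓘(ℝ, F) ∞ Y]

/-- On a compact manifold with a tamed almost complex structure `J`, a quadratic function on the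
tangent bundle is bounded by the energy `Ω(v, Jv)`. -/
theorem IsCompatible.exists_le_mul_energy {Ω : Form E X 2} {J : AlmostComplexStructure E X}
    (hJ : IsCompatible Ω J) {P : TangentBundle 𝓘(ℝ, E) X → ℝ} (hP : Continuous P)
    (hPh : ∀ (x : X) (c : ℝ) (v : TangentSpace 𝓘(ℝ, E) x), P ⟨x, c • v⟩ = c ^ 2 * P ⟨x, v⟩) :
    ∃ C : ℝ, 0 ≤ C ∧ ∀ (x : X) (v : TangentSpace 𝓘(ℝ, E) x),
      P ⟨x, v⟩ ≤ C * Ω.1 x ![v, J.toFun x v] := by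
  obtain ⟨C, hC, h⟩ := exists_le_mul_of_homogeneous hP (continuous_energy Ω J) hPh
    (fun x c v => by
      have : ![c • v, J.toFun x (c • v)] = fun i => c • ![v, J.toFun x v] i := by
        ext i; fin_cases i <;> simp
      change Ω.1 x ![c • v, J.toFun x (c • v)] = c ^ 2 * Ω.1 x ![v, J.toFun x v]
      rw [this]
      exact ((Ω.1 x).toMultilinearMap.map_smul_univ (fun _ => c) _).trans (by simp)) hJ.tames
  exact ⟨C, hC, fun x v => h ⟨x, v⟩⟩

/-- A `J`-holomorphic plane is constant if the symplectic form is, up to an exact form, the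
pullback of a `d̃`-bounded form. -/
theorem IsJHolomorphic.eq_of_isTildeDBounded {Ω : Form E X 2} {J : AlmostComplexStructure E X}
    (hJ : IsCompatible Ω J)
    (g : Bundle.ContMDiffRiemannianMetric 𝓘(ℝ, F) ∞ F (fun y : Y => TangentSpace 𝓘(ℝ, F) y))
    (f₁ : C^∞⟮𝓘(ℝ, E), X; 𝓘(ℝ, F), Y⟯) {α : Form F Y 2} (hα : IsTildeDBounded g α)
    {η : Form E X 1} (hΩ : Ω = pullback f₁ 2 α + d η) {f : ℂ → X} (hf : IsJHolomorphic J f)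
    (z w : ℂ) : f z = f w := by
  obtain ⟨U, β, hβ, C, hC⟩ := hα
  let f₀ : C^∞⟮𝓘(ℝ, ℂ), ℂ; 𝓘(ℝ, E), X⟯ := ⟨f, hf.smooth⟩
  obtain ⟨h, hh⟩ := U.exists_lift (f₁.comp f₀)
  let θ : Form ℂ ℂ 1 := pullback h 1 β + pullback f₀ 1 η
  have hθ : pullback f₀ 2 Ω = d θ := by
    rw [hΩ, map_add, map_add, d_pullback, d_pullback, ← hβ, ← pullback_comp, ← pullback_comp, hh]
  -- Both functions compared with the energy are squares, hence quadratic on fibres: the squared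
  -- length of `df₁(v)`, then `η(v)²`.
  obtain ⟨C₁, hC₁, hgC⟩ := hJ.exists_le_mul_energy
    (P := fun p => g.inner (f₁ p.1) (mfderiv 𝓘(ℝ, E) 𝓘(ℝ, F) f₁ p.1 p.2)
      (mfderiv 𝓘(ℝ, E) 𝓘(ℝ, F) f₁ p.1 p.2))
    ((continuous_metric_apply g).comp (f₁.contMDiff.continuous_tangentMap (by simp)))
    (fun x c v => by simp only [map_smul, smul_apply, smul_eq_mul]; ring)
  obtain ⟨C₂, hC₂, hηC⟩ := hJ.exists_le_mul_energy (P := fun p => (η.1 p.1 fun _ => p.2) ^ 2)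
    ((continuous_form_apply η (FiberBundle.continuous_proj E _) (fun p _ => p.2)
      fun _ => continuous_id).pow 2)
    (fun x c v => by
      have : (η.1 x fun _ => c • v) = c * η.1 x fun _ => v :=
        ((η.1 x).toMultilinearMap.map_smul_univ (fun _ => c) fun _ => v).trans (by simp)
      simp only [this]; ring)
  let D : ∀ z : ℂ, ℂ → TangentSpace 𝓘(ℝ, E) (f z) := fun z v => mfderiv 𝓘(ℝ, ℂ) 𝓘(ℝ, E) f z v
  let e : ℂ → ℂ → ℝ := fun z v => Ω.1 (f z) ![D z v, J.toFun (f z) (D z v)]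
  have hI : ∀ z, D z Complex.I = J.toFun (f z) (D z 1) := fun z => by
    have := hf.map_I_mul z 1
    rwa [mul_one] at this
  have he0 : ∀ z v, 0 ≤ e z v := fun z v => by
    by_cases hv : D z v = 0
    · refine (?_ : e z v = 0).ge
      exact (Ω.1 (f z)).map_coord_zero 0 hv
    · exact (hJ.tames _ _ hv).le
  -- By `J`-invariance both coordinate directions have the same energy, so one density `u` controls
  -- both coefficients of `θ`.
  have heI : ∀ z, e z Complex.I = e z 1 := fun z => by
    simp only [e, hI]
    exact hJ.invariant _ _ _
  have hu : ∀ z, e z 1 = onModel (d θ).1 z ![1, Complex.I] := fun z => by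
    rw [← hθ]
    simp only [e, ← hI]
    change _ = Ω.1 (f z) (D z ∘ ![1, Complex.I])
    congr 1
    ext i; fin_cases i <;> rfl
  have hpr : ∀ z v, g.inner (f₁ (f z)) (mfderiv 𝓘(ℝ, E) 𝓘(ℝ, F) f₁ (f z) (D z v))
      (mfderiv 𝓘(ℝ, E) 𝓘(ℝ, F) f₁ (f z) (D z v)) =
      U.metric g (h z) (mfderiv 𝓘(ℝ, ℂ) 𝓘(ℝ, F) h z v) (mfderiv 𝓘(ℝ, ℂ) 𝓘(ℝ, F) h z v) := by
    intro z v
    -- Both sides are squared lengths of one tangent vector, since `f₁ ∘ f = π ∘ h`. The base points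
    -- are only propositionally equal, so the comparison is made in the total space of the tangent
    -- bundle.
    let q : TangentBundle 𝓘(ℝ, F) Y → ℝ := fun p => g.inner p.1 p.2 p.2
    let p₀ : TangentBundle 𝓘(ℝ, ℂ) ℂ := ⟨z, v⟩
    have t1 := tangentMap_comp_at (I := 𝓘(ℝ, ℂ)) (I' := 𝓘(ℝ, E)) (I'' := 𝓘(ℝ, F)) (g := f₁)
      (f := f₀) p₀ (f₁.contMDiff.mdifferentiable (by simp) _)
      (f₀.contMDiff.mdifferentiable (by simp) _)
    have t2 := tangentMap_comp_at (I := 𝓘(ℝ, ℂ)) (I' := 𝓘(ℝ, F)) (I'' := 𝓘(ℝ, F)) (g := U.proj)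
      (f := h) p₀ (U.proj.contMDiff.mdifferentiable (by simp) _)
      (h.contMDiff.mdifferentiable (by simp) _)
    have hfun : (U.proj ∘ h : ℂ → Y) = f₁ ∘ f₀ := congrArg DFunLike.coe hh
    rw [hfun] at t2
    exact congrArg q (t1.symm.trans t2)
  -- The `β` part contributes `|C| √C₁`, with an absolute value because `C` has no prescribed sign;
  -- the `η` part contributes `√C₂`.
  have hbound : ∀ z v, |onModel θ.1 z ![v]| ≤ (|C| * √C₁ + √C₂) * √(e z v) := by
    intro z v
    have k1 : |β.1 (h z) fun _ => mfderiv 𝓘(ℝ, ℂ) 𝓘(ℝ, F) h z v| ≤ |C| * (√C₁ * √(e z v)) := by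
      have := hC (h z) fun _ => mfderiv 𝓘(ℝ, ℂ) 𝓘(ℝ, F) h z v
      rw [Fin.prod_univ_one, ← hpr] at this
      refine this.trans (mul_le_mul (le_abs_self C) ?_ (Real.sqrt_nonneg _) (abs_nonneg _))
      rw [← Real.sqrt_mul hC₁]
      exact Real.sqrt_le_sqrt (hgC _ _)
    have k2 : |η.1 (f z) fun _ => D z v| ≤ √C₂ * √(e z v) := by
      rw [← Real.sqrt_sq_eq_abs, ← Real.sqrt_mul hC₂]
      exact Real.sqrt_le_sqrt (hηC _ _)
    have k3 : onModel θ.1 z ![v] = (β.1 (h z) fun _ => mfderiv 𝓘(ℝ, ℂ) 𝓘(ℝ, F) h z v) +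
        η.1 (f z) fun _ => D z v := by
      change β.1 (h z) (mfderiv 𝓘(ℝ, ℂ) 𝓘(ℝ, F) h z ∘ ![v]) + η.1 (f z) (D z ∘ ![v]) = _
      congr 2 <;> (ext i; fin_cases i; rfl)
    rw [k3]
    refine (abs_add_le _ _).trans ((add_le_add k1 k2).trans_eq ?_)
    ring
  have hzero : ∀ z, e z 1 = 0 := eq_zero_of_primitive_le
    (p := fun z => onModel θ.1 z ![1]) (q := fun z => onModel θ.1 z ![Complex.I])
    ((contDiff_form_apply θ _).of_le (by simp)) ((contDiff_form_apply θ _).of_le (by simp))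
    (fun z => he0 z 1) (fun z => (hu z).trans (d_apply_plane θ z)) (fun z => hbound z 1)
    (fun z => by rw [← heI]; exact hbound z Complex.I)
  refine eq_of_mfderiv_eq_zero hf.smooth (fun z => ?_) z w
  -- Taming turns zero energy into `D 1 = 0`; then `D i = J (D 1) = 0`, and `1` and `i` span `ℂ`
  -- over the reals.
  have h1 : D z 1 = 0 := by
    by_contra hne
    exact (hJ.tames _ _ hne).ne' (hzero z)
  have h2 : D z Complex.I = 0 := by rw [hI, h1, map_zero]
  refine ContinuousLinearMap.ext fun v => ?_
  have hv : v = (v.re • (1 : ℂ) + v.im • Complex.I : ℂ) := by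
    rw [Complex.real_smul, Complex.real_smul, mul_one]
    exact (Complex.re_add_im v).symm
  change D z v = 0
  have : D z (v.re • (1 : ℂ) + v.im • Complex.I : ℂ) = v.re • D z 1 + v.im • D z Complex.I :=
    ((mfderiv 𝓘(ℝ, ℂ) 𝓘(ℝ, E) f z).map_add _ _).trans
      (congrArg₂ (· + ·) ((mfderiv 𝓘(ℝ, ℂ) 𝓘(ℝ, E) f z).map_smul _ _)
        ((mfderiv 𝓘(ℝ, ℂ) 𝓘(ℝ, E) f z).map_smul _ _))
  rw [hv, this, h1, h2, smul_zero, smul_zero, add_zero]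

end Holomorphic

end DiffForm

theorem theorem4p1
    {E : Type*} [NormedAddCommGroup E] [NormedSpace ℝ E] [FiniteDimensional ℝ E]
    {X : Type*} [TopologicalSpace X] [T2Space X] [CompactSpace X] [ChartedSpace E X]
    [IsManifold 𝓘(ℝ, E) ∞ X]
    {F : Type*} [NormedAddCommGroup F] [NormedSpace ℝ F] [FiniteDimensional ℝ F]
    {Y : Type*} [TopologicalSpace Y] [T2Space Y] [CompactSpace Y] [ConnectedSpace Y]
    [ChartedSpace F Y] [IsManifold 𝓘(ℝ, F) ∞ Y]
    (g : Bundle.ContMDiffRiemannianMetric 𝓘(ℝ, F) ∞ F (fun y : Y => TangentSpace 𝓘(ℝ, F) y))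
    (hY : DiffForm.HasTildeDBoundedCohomology g 2)
    (f₁ : C^∞⟮𝓘(ℝ, E), X; 𝓘(ℝ, F), Y⟯) (f₂ : C^∞⟮𝓘(ℝ, F), Y; 𝓘(ℝ, E), X⟯)
    (Ω : DiffForm.Form E X 2) (hΩ : DiffForm.IsSymplectic Ω)
    (hmem : DiffForm.deRhamClass Ω hΩ.closed ∈
      LinearMap.range (DiffForm.deRhamMap (f₂.comp f₁) 2))
    (J : DiffForm.AlmostComplexStructure E X) (hJ : DiffForm.IsCompatible Ω J) :
    ¬ ∃ f : ℂ → X, DiffForm.IsJHolomorphic J f ∧ ¬ ∃ p : X, ∀ z : ℂ, f z = p := by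
  rintro ⟨f, hf, hne⟩
  obtain ⟨α, η, hα, hΩη⟩ := DiffForm.exists_eq_pullback_add_d f₁ f₂ hY hΩ.closed hmem
  exact hne ⟨f 0, fun z => hf.eq_of_isTildeDBounded hJ g f₁ hα hΩη z 0⟩
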